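/- Definitions. All graphs are directed graphs on the known vertex set $V=\{0,\dots,n-1\}$. A rooted DAG is an acyclic directed graph with exactly one vertex of in-degree $0$ (the root). An arborescence is a rooted DAG with exactly one directed path from the root to each vertex. An almost-tree is a rooted DAG that is the union of an arborescence $T$ and one additional cross edge $(s,t)$, where $s\neq t$ and neither of $s,t$ is an ancestor of the other in $T$; its height is the number of edges of a longest directed path. It has degree $d$ if in-degree plus out-degree of every vertex is at most $d$. An edge $(u,v)$ is transitive if there is a directed path of length greater than $1$ from $u$ to $v$. Let $\mathcal A(n,h,d)$ be the set of degree-$d$ almost-trees of height exactly $h$ on $V$ that have no transitive edge. A path query $\mathsf{path}(u,v)$ returns whether the hidden graph $G$ has a directed path (possibly of length $0$) from $u$ to $v$. A deterministic algorithm is an adaptive decision tree of path queries that finally outputs a graph; a randomized algorithm is a probability distribution over deterministic ones. Theorem. For every $d\in\mathbb N$ and every $\varepsilon>0$ there is a constant $c=c(d,\varepsilon)>0$ such that the following holds for all $n,h$ with $\mathcal A(n,h,d)\neq\emptyset$. Put $B=c\,n\log n$; moreover, if $d\ge 3$ and $h\le(1-\varepsilon)n$, the same two assertions also hold with $B=c\,(n\log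 n+nh)$. (1) For every deterministic algorithm that outputs $G$ for every hidden graph $G\in\mathcal A(n,h,d)$, there is a $G\in\mathcal A(n,h,d)$ on which it asks at least $B$ path queries. (2) For every randomized algorithm that, for every hidden graph $G\in\mathcal A(n,h,d)$, outputs $G$ with probability at least $2/3$ (in particular, for every one that never errs), there is a $G\in\mathcal A(n,h,d)$ on which its expected number of path queries is at least $B$. -/

import Mathlib

universe u

namespace PathLearning

open scoped ENNReal

/-- `p` lists the successive vertices of a directed path of `G` from `a` to `b`
(the one-vertex list is the path of length zero). In an acyclic graph vertices cannot repeat. -/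
def IsPath {V : Type u} (G : Digraph V) (a b : V) (p : List V) : Prop :=
  p.IsChain G.Adj ∧ p.head? = some a ∧ p.getLast? = some b

/-- The answer to the path query `path(a, b)`: there is a directed path from `a` to `b`. -/
def PathQuery {V : Type u} (G : Digraph V) (a b : V) : Prop :=
  ∃ p : List V, IsPath G a b p

/-- A DAG: there is no directed path of positive length from a vertex to itself. -/
def IsDAG {V : Type u} (G : Digraph V) : Prop :=
  ∀ v : V, ¬ Relation.TransGen G.Adj v v

/-- A root is a vertex of in-degree zero. -/
def IsRoot {V : Type u} (G : Digraph V) (r : V) : Prop :=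
  ∀ v : V, ¬ G.Adj v r

/-- A rooted DAG is a DAG with exactly one root. -/
def IsRootedDAG {V : Type u} (G : Digraph V) : Prop :=
  IsDAG G ∧ ∃! r : V, IsRoot G r

/-- An arborescence: a rooted DAG with exactly one directed path from its root to each vertex. -/
def IsArborescence {V : Type u} (T : Digraph V) : Prop :=
  IsRootedDAG T ∧ ∀ r : V, IsRoot T r → ∀ v : V, ∃! p : List V, IsPath T r v p

/-- An almost-tree: a rooted DAG that is the union of an arborescence `T` and one additional
cross edge `(s, t)`, i.e. an edge between vertices neither of which is an ancestor of
(or equal to) the other in `T`. -/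
def IsAlmostTree {V : Type u} (G : Digraph V) : Prop :=
  IsRootedDAG G ∧ ∃ (T : Digraph V) (s t : V), IsArborescence T ∧
    ¬ PathQuery T s t ∧ ¬ PathQuery T t s ∧
    ∀ a b : V, G.Adj a b ↔ T.Adj a b ∨ (a = s ∧ b = t)

/-- An edge `(a, b)` is transitive if there is a directed path of length greater than one
from `a` to `b`. -/
def IsTransitiveEdge {V : Type u} (G : Digraph V) (a b : V) : Prop :=
  G.Adj a b ∧ ∃ p : List V, IsPath G a b p ∧ 2 < p.length

/-- Every vertex has in-degree plus out-degree at most `d`. -/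
def HasMaxDegree {V : Type u} (G : Digraph V) (d : ℕ) : Prop :=
  ∀ v : V, {a : V | G.Adj a v}.ncard + {b : V | G.Adj v b}.ncard ≤ d

/-- The longest directed path of `G` has length (number of edges) `h`. -/
def HasHeight {V : Type u} (G : Digraph V) (h : ℕ) : Prop :=
  IsGreatest {k : ℕ | ∃ (a b : V) (p : List V), IsPath G a b p ∧ p.length = k + 1} h

/-- The degree-`d` almost-trees of height `h` on the vertex set `{0, …, n - 1}` that have no
transitive edges. -/
def almostTrees (d h n : ℕ) : Set (Digraph (Fin n)) :=
  {G | IsAlmostTree G ∧ (∀ a b, ¬ IsTransitiveEdge G a b) ∧ HasMaxDegree G d ∧ HasHeight G h}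

/-- A deterministic adaptive algorithm that learns a graph on the known vertex set `V` by path
queries: it either stops and outputs a graph, or asks `path(a, b)` and continues
according to the answer. -/
inductive QueryAlg (V : Type u) : Type u where
  | output (G : Digraph V) : QueryAlg V
  | query (a b : V) (onYes onNo : QueryAlg V) : QueryAlg V

open Classical in
/-- The graph that the algorithm outputs when the hidden graph is `G`. -/
noncomputable def QueryAlg.run {V : Type u} (G : Digraph V) : QueryAlg V → Digraph V
  | .output H => H
  | .query a b onYes onNo => if PathQuery G a b then onYes.run G else onNo.run G

open Classical in
/-- The number of path queries that the algorithm asks when the hidden graph is `G`. -/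
noncomputable def QueryAlg.cost {V : Type u} (G : Digraph V) : QueryAlg V → ℕ
  | .output _ => 0
  | .query a b onYes onNo => (if PathQuery G a b then onYes.cost G else onNo.cost G) + 1

/-- A randomized algorithm is a probability distribution over deterministic ones; this is its
expected number of path queries when the hidden graph is `G`. -/
noncomputable def expectedCost {V : Type u} (P : PMF (QueryAlg V)) (G : Digraph V) : ℝ≥0∞ :=
  ∑' A : QueryAlg V, P A * (A.cost G : ℝ≥0∞)

/-- The probability that the randomized algorithm outputs the hidden graph `G`. -/
noncomputable def successProb {V : Type u} (P : PMF (QueryAlg V)) (G : Digraph V) : ℝ≥0∞ :=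
  P.toOuterMeasure {A : QueryAlg V | A.run G = G}

/-- Every deterministic algorithm that learns all graphs of the class `C` asks at least `B`
queries on some graph of `C`. -/
def DeterministicLowerBound {V : Type u} (C : Set (Digraph V)) (B : ℝ) : Prop :=
  ∀ A : QueryAlg V, (∀ G ∈ C, A.run G = G) → ∃ G ∈ C, B ≤ (A.cost G : ℝ)

/-- Every randomized algorithm that learns each graph of the class `C` with probability at least
`2 / 3` (in particular every one that never errs) asks at least `B` queries in expectation
on some graph of `C`. -/
def RandomizedLowerBound {V : Type u} (C : Set (Digraph V)) (B : ℝ) : Prop :=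
  ∀ P : PMF (QueryAlg V), (∀ G ∈ C, 2 / 3 ≤ successProb P G) →
    ∃ G ∈ C, ENNReal.ofReal B ≤ expectedCost P G

end PathLearning

/-! Both bounds come from averaging over a finite subfamily
(`randomizedLowerBound_of_card_identified`): if no decision tree identifies more than a third of the
family within `q` queries, success probability 2/3 costs at least `(q + 1) / 3` expected queries on
some member. The deterministic bounds follow by taking point masses.

For `n log n`, the class is closed under renaming vertices. A renaming of a fixed member is
determined by the resulting graph and by which child of its parent each vertex becomes, so at most
`(d + 1) ^ n` renamings coincide (`card_relabel_fiber_le`). The class thus has at least `n! / (d +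
1) ^ n` members, while `q` binary answers separate only `2 ^ q`.

For `n h`, the hard instances are a search problem. A broom has a spine of length `h`, pendant
leaves at its first `k` vertices, and a binary heap hanging from spine vertex `k`. Add an edge from
a pendant leaf `s` to a heap leaf `t`. Every proper ancestor of `s` already reaches `t`, so
reachability changes in the pair `(s, t)` only (`pathQuery_addEdge`), and each query tests at most
one candidate (`QueryAlg.card_identified_le_of_search`). With `k` of order `h` and order `n` heap
leaves there are order `n h` candidates. The heap needs `h` to exceed a multiple of `log n`; for
smaller `h` the term `n h` is absorbed by `n log n`. -/

namespace PathLearning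

open scoped ENNReal

/-! ### Decision trees and averaging over hidden graphs -/

section QueryComplexity

variable {V : Type u}

lemma RandomizedLowerBound.mono {C : Set (Digraph V)} {B B' : ℝ}
    (hC : RandomizedLowerBound C B) (h : B' ≤ B) : RandomizedLowerBound C B' := by
  intro P hP
  obtain ⟨G, hG, hB⟩ := hC P hP
  exact ⟨G, hG, (ENNReal.ofReal_le_ofReal h).trans hB⟩

lemma RandomizedLowerBound.deterministic {C : Set (Digraph V)} {B : ℝ}
    (hC : RandomizedLowerBound C B) : DeterministicLowerBound C B := by
  classical
  intro A hA
  obtain ⟨G, hG, hB⟩ := hC (PMF.pure A) (by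
    intro G hG
    have h1 : successProb (PMF.pure A) G = 1 := by
      rw [successProb, PMF.toOuterMeasure_pure_apply, if_pos]
      exact hA G hG
    rw [h1]
    exact ENNReal.div_le_of_le_mul (by norm_num))
  refine ⟨G, hG, ?_⟩
  have hcost : expectedCost (PMF.pure A) G = (A.cost G : ℝ≥0∞) := by
    rw [expectedCost, tsum_eq_single A]
    · simp
    · intro A' hA'
      simp [PMF.pure_apply, hA']
  rw [hcost] at hB
  have := (ENNReal.ofReal_le_iff_le_toReal (by simp)).1 hB
  simpa using this

open Classical in
/-- The members of `F` that `A` identifies correctly with at most `q` queries. -/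
noncomputable def QueryAlg.identified (A : QueryAlg V) (F : Finset (Digraph V)) (q : ℕ) :
    Finset (Digraph V) :=
  F.filter fun G => A.run G = G ∧ A.cost G ≤ q

lemma QueryAlg.mem_identified {A : QueryAlg V} {F : Finset (Digraph V)} {q : ℕ} {G : Digraph V} :
    G ∈ A.identified F q ↔ G ∈ F ∧ A.run G = G ∧ A.cost G ≤ q := by
  simp [identified]

lemma QueryAlg.card_identified_output_le (H : Digraph V) (F : Finset (Digraph V)) (q : ℕ) :
    ((QueryAlg.output H).identified F q).card ≤ 1 := by
  refine Finset.card_le_one.2 fun a ha b hb => ?_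
  have ha' := (mem_identified.1 ha).2.1
  have hb' := (mem_identified.1 hb).2.1
  exact ha'.symm.trans hb'

lemma QueryAlg.identified_query_zero (a b : V) (y n : QueryAlg V) (F : Finset (Digraph V)) :
    (QueryAlg.query a b y n).identified F 0 = ∅ := by
  simp [identified, QueryAlg.cost]

open Classical in
lemma QueryAlg.identified_query_succ (a b : V) (y n : QueryAlg V) (F : Finset (Digraph V))
    (q : ℕ) :
    (QueryAlg.query a b y n).identified F (q + 1) =
      y.identified (F.filter fun G => PathQuery G a b) q ∪
        n.identified (F.filter fun G => ¬ PathQuery G a b) q := by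
  ext G
  by_cases h : PathQuery G a b <;>
    simp [identified, QueryAlg.run, QueryAlg.cost, h]

/-- A decision tree of depth `q` has at most `2 ^ q` leaves. -/
lemma QueryAlg.card_identified_le_two_pow (A : QueryAlg V) (F : Finset (Digraph V)) (q : ℕ) :
    (A.identified F q).card ≤ 2 ^ q := by
  classical
  induction A generalizing F q with
  | output H => exact (card_identified_output_le H F q).trans Nat.one_le_two_pow
  | query a b y n hy hn =>
    cases q with
    | zero => simp [identified_query_zero]
    | succ q =>
      rw [identified_query_succ, pow_succ, mul_two]
      exact (Finset.card_union_le _ _).trans (Nat.add_le_add (hy _ q) (hn _ q))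

/-- Searching among graphs each of which differs from a common reachability relation in a
single pair of its own: every query rules out at most one of them. -/
lemma QueryAlg.card_identified_le_of_search (R : V → V → Prop) (pos : Digraph V → V × V)
    (A : QueryAlg V) (F : Finset (Digraph V)) (hinj : Set.InjOn pos F)
    (hF : ∀ G ∈ F, ∀ a b, PathQuery G a b ↔ R a b ∨ (a, b) = pos G) (q : ℕ) :
    (A.identified F q).card ≤ q + 1 := by
  classical
  induction A generalizing F q with
  | output H => exact (card_identified_output_le H F q).trans (Nat.le_add_left _ _)
  | query a b y n hy hn =>
    cases q with
    | zero => simp [identified_query_zero]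
    | succ q =>
      rw [identified_query_succ]
      refine (Finset.card_union_le _ _).trans ?_
      have hn' := hn (F.filter fun G => ¬ PathQuery G a b)
        (hinj.mono (Finset.coe_subset.2 (Finset.filter_subset _ _)))
        (fun G hG => hF G (Finset.mem_of_mem_filter G hG)) q
      have hy' := hy (F.filter fun G => PathQuery G a b)
        (hinj.mono (Finset.coe_subset.2 (Finset.filter_subset _ _)))
        (fun G hG => hF G (Finset.mem_of_mem_filter G hG)) q
      -- A pair in `R` is answered yes by every candidate. Otherwise only the candidate whose own
      -- pair is `(a, b)` says yes, so the yes-branch identifies at most one graph.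
      by_cases hR : R a b
      · have : F.filter (fun G => ¬ PathQuery G a b) = ∅ := by
          rw [Finset.filter_eq_empty_iff]
          intro G hG
          simp [hF G hG, hR]
        rw [this]
        simp only [identified, Finset.filter_empty, Finset.card_empty] at hy' ⊢
        omega
      · have h1 : (y.identified (F.filter fun G => PathQuery G a b) q).card ≤ 1 := by
          refine Finset.card_le_one.2 ?_
          intro G hG G' hG'
          simp only [mem_identified, Finset.mem_filter] at hG hG'
          have e := ((hF G hG.1.1 a b).1 hG.1.2).resolve_left hR
          have e' := ((hF G' hG'.1.1 a b).1 hG'.1.2).resolve_left hR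
          exact hinj hG.1.1 hG'.1.1 (e.symm.trans e')
        omega

/-- Averaging over a finite subfamily: if no deterministic algorithm identifies more than a third
of the family with `q` queries, then randomized algorithms need `(q + 1) / 3` queries. -/
lemma randomizedLowerBound_of_card_identified {C : Set (Digraph V)} (F : Finset (Digraph V))
    (hF : F.Nonempty) (hFC : ∀ G ∈ F, G ∈ C) (q : ℕ)
    (hq : ∀ A : QueryAlg V, 3 * (A.identified F q).card ≤ F.card) :
    RandomizedLowerBound C (((q + 1 : ℕ) : ℝ) / 3) := by
  classical
  intro P hP
  by_contra hcon
  push Not at hcon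
  have hB : ENNReal.ofReal (((q + 1 : ℕ) : ℝ) / 3) = ((q + 1 : ℕ) : ℝ≥0∞) / 3 := by
    rw [ENNReal.ofReal_div_of_pos (by norm_num), ENNReal.ofReal_natCast]
    norm_num
  rw [hB] at hcon
  -- A graph answered correctly is either identified within `q` queries or costs at least `q + 1`.
  have hpoint : ∀ A : QueryAlg V,
      3 * (q + 1) * (F.filter fun G => A.run G = G).card ≤
        (q + 1) * F.card + 3 * ∑ G ∈ F, A.cost G := by
    intro A
    have h1 : (q + 1) * (F.filter fun G => A.run G = G).card ≤
        (q + 1) * (A.identified F q).card + ∑ G ∈ F, A.cost G := by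
      simp only [QueryAlg.identified, Finset.card_filter, Finset.mul_sum]
      rw [← Finset.sum_add_distrib]
      refine Finset.sum_le_sum fun G _ => ?_
      by_cases hr : A.run G = G
      · by_cases hc : A.cost G ≤ q
        · simp [hr, hc]
        · simp only [hr, hc]; simp; omega
      · simp [hr]
    have h2 := Nat.mul_le_mul_left (q + 1) (hq A)
    nlinarith
  have hsucc : ∀ G, successProb P G = ∑' A : QueryAlg V, P A * (if A.run G = G then 1 else 0) := by
    intro G
    rw [successProb, PMF.toOuterMeasure_apply]
    refine tsum_congr fun A => ?_
    by_cases h : A.run G = G <;> simp [Set.indicator, h]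
  have hleft : ∑ G ∈ F, successProb P G =
      ∑' A : QueryAlg V, P A * ((F.filter fun G => A.run G = G).card : ℝ≥0∞) := by
    simp only [hsucc]
    rw [← Summable.tsum_finsetSum (fun _ _ => ENNReal.summable)]
    refine tsum_congr fun A => ?_
    rw [← Finset.mul_sum]
    simp [Finset.sum_boole]
  have hright : ∑ G ∈ F, expectedCost P G =
      ∑' A : QueryAlg V, P A * ((∑ G ∈ F, A.cost G : ℕ) : ℝ≥0∞) := by
    simp only [expectedCost]
    rw [← Summable.tsum_finsetSum (fun _ _ => ENNReal.summable)]
    refine tsum_congr fun A => ?_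
    rw [← Finset.mul_sum]
    simp
  have hmain : 3 * ((q : ℝ≥0∞) + 1) * ∑ G ∈ F, successProb P G ≤
      (q + 1) * F.card + 3 * ∑ G ∈ F, expectedCost P G := by
    have hone : ((q : ℝ≥0∞) + 1) * F.card =
        ∑' A : QueryAlg V, P A * (((q : ℝ≥0∞) + 1) * F.card) := by
      rw [ENNReal.tsum_mul_right, P.tsum_coe, one_mul]
    rw [hleft, hright, hone, ← ENNReal.tsum_mul_left, ← ENNReal.tsum_mul_left,
      ← ENNReal.tsum_add]
    refine ENNReal.tsum_le_tsum fun A => ?_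
    have h := hpoint A
    have h' : 3 * ((q : ℝ≥0∞) + 1) * ((F.filter fun G => A.run G = G).card : ℝ≥0∞) ≤
        ((q : ℝ≥0∞) + 1) * F.card + 3 * ((∑ G ∈ F, A.cost G : ℕ) : ℝ≥0∞) := by
      exact_mod_cast h
    calc _ = P A * (3 * ((q : ℝ≥0∞) + 1) * ((F.filter fun G => A.run G = G).card : ℝ≥0∞)) := by
          ring
      _ ≤ P A * (((q : ℝ≥0∞) + 1) * F.card + 3 * ((∑ G ∈ F, A.cost G : ℕ) : ℝ≥0∞)) := by
          gcongr
      _ = _ := by ring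
  -- Success 2/3 makes the left side of `hmain` at least `2 (q + 1) |F|`; expected costs below `(q +
  -- 1) / 3` make its right side strictly smaller.
  have hlow : (F.card : ℝ≥0∞) * (2 / 3) ≤ ∑ G ∈ F, successProb P G := by
    rw [← nsmul_eq_mul]
    exact Finset.card_nsmul_le_sum _ _ _ fun G hG => hP G (hFC G hG)
  have hup : ∑ G ∈ F, expectedCost P G < F.card * (((q + 1 : ℕ) : ℝ≥0∞) / 3) := by
    rw [← nsmul_eq_mul, ← Finset.sum_const]
    exact ENNReal.sum_lt_sum_of_nonempty hF fun G hG => hcon G (hFC G hG)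
  have h3 : (3 : ℝ≥0∞) * (((q + 1 : ℕ) : ℝ≥0∞) / 3) = q + 1 := by
    rw [ENNReal.mul_div_cancel (by norm_num) (by norm_num)]
    push_cast; rfl
  have h23 : (3 : ℝ≥0∞) * (2 / 3) = 2 := ENNReal.mul_div_cancel (by norm_num) (by norm_num)
  have hlt : (q + 1) * F.card + 3 * ∑ G ∈ F, expectedCost P G <
      ((q : ℝ≥0∞) + 1) * F.card + (q + 1) * F.card := by
    refine ENNReal.add_lt_add_left (by finiteness) ?_
    calc 3 * ∑ G ∈ F, expectedCost P G < 3 * (F.card * (((q + 1 : ℕ) : ℝ≥0∞) / 3)) :=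
          ENNReal.mul_lt_mul_right (by norm_num) (by norm_num) hup
      _ = F.card * (3 * (((q + 1 : ℕ) : ℝ≥0∞) / 3)) := by ring
      _ = _ := by rw [h3, mul_comm]
  refine absurd (hmain.trans_lt hlt) (not_lt.2 ?_)
  calc ((q : ℝ≥0∞) + 1) * F.card + (q + 1) * F.card
      = (q + 1) * (F.card * (3 * (2 / 3))) := by rw [h23]; ring
    _ = 3 * ((q : ℝ≥0∞) + 1) * (F.card * (2 / 3)) := by ring
    _ ≤ _ := by gcongr

end QueryComplexity

/-! ### Invariance under renaming of vertices -/

section Relabel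

variable {V : Type u}

/-- The graph `G` with its vertices renamed by `σ`. -/
def relabel (G : Digraph V) (σ : Equiv.Perm V) : Digraph V :=
  ⟨fun a b => G.Adj (σ a) (σ b)⟩

lemma isPath_relabel {G : Digraph V} (σ : Equiv.Perm V) {a b : V} {p : List V} :
    IsPath (relabel G σ) a b p ↔ IsPath G (σ a) (σ b) (p.map σ) := by
  simp only [IsPath, List.isChain_map, List.head?_map, List.getLast?_map, relabel]
  simp [Option.map_eq_some_iff]

lemma exists_list_map_iff (σ : Equiv.Perm V) {P : List V → Prop} :
    (∃ p : List V, P (p.map σ)) ↔ ∃ p, P p :=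
  ⟨fun ⟨p, hp⟩ => ⟨_, hp⟩, fun ⟨p, hp⟩ => ⟨p.map σ.symm, by simpa using hp⟩⟩

lemma pathQuery_relabel {G : Digraph V} (σ : Equiv.Perm V) {a b : V} :
    PathQuery (relabel G σ) a b ↔ PathQuery G (σ a) (σ b) := by
  simp only [PathQuery, isPath_relabel]
  exact exists_list_map_iff σ (P := fun p => IsPath G (σ a) (σ b) p)

lemma IsDAG.relabel {G : Digraph V} (h : IsDAG G) (σ : Equiv.Perm V) : IsDAG (relabel G σ) := by
  intro v hv
  exact h (σ v) (hv.lift σ fun _ _ hab => hab)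

lemma isRoot_relabel {G : Digraph V} (σ : Equiv.Perm V) {r : V} :
    IsRoot (relabel G σ) r ↔ IsRoot G (σ r) := by
  simp only [IsRoot, PathLearning.relabel]
  rw [σ.forall_congr_left]
  simp

lemma IsRootedDAG.relabel {G : Digraph V} (h : IsRootedDAG G) (σ : Equiv.Perm V) :
    IsRootedDAG (relabel G σ) := by
  obtain ⟨hd, r, hr, hu⟩ := h
  refine ⟨hd.relabel σ, σ.symm r, ?_, ?_⟩
  · simpa [isRoot_relabel] using hr
  · intro r' hr'
    rw [Equiv.eq_symm_apply]
    exact hu _ ((isRoot_relabel σ).1 hr')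

lemma IsArborescence.relabel {T : Digraph V} (h : IsArborescence T) (σ : Equiv.Perm V) :
    IsArborescence (relabel T σ) := by
  refine ⟨h.1.relabel σ, fun r hr v => ?_⟩
  obtain ⟨p, hp, hu⟩ := h.2 _ ((isRoot_relabel σ).1 hr) (σ v)
  refine ⟨p.map σ.symm, ?_, ?_⟩
  · simpa [isPath_relabel] using hp
  · intro p' hp'
    rw [← hu _ ((isPath_relabel σ).1 hp')]
    simp

lemma IsAlmostTree.relabel {G : Digraph V} (h : IsAlmostTree G) (σ : Equiv.Perm V) :
    IsAlmostTree (relabel G σ) := by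
  obtain ⟨hr, T, s, t, hT, hst, hts, hadj⟩ := h
  refine ⟨hr.relabel σ, PathLearning.relabel T σ, σ.symm s, σ.symm t, hT.relabel σ, ?_, ?_, ?_⟩
  · simpa [pathQuery_relabel] using hst
  · simpa [pathQuery_relabel] using hts
  · intro a b
    simp only [PathLearning.relabel, hadj, Equiv.eq_symm_apply]

lemma IsTransitiveEdge.of_relabel {G : Digraph V} {σ : Equiv.Perm V} {a b : V}
    (h : IsTransitiveEdge (relabel G σ) a b) : IsTransitiveEdge G (σ a) (σ b) := by
  obtain ⟨hab, p, hp, hl⟩ := h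
  exact ⟨hab, p.map σ, (isPath_relabel σ).1 hp, by simpa using hl⟩

lemma HasMaxDegree.relabel {G : Digraph V} {d : ℕ} (h : HasMaxDegree G d) (σ : Equiv.Perm V) :
    HasMaxDegree (relabel G σ) d := by
  intro v
  have key : ∀ P : V → Prop, {a | P (σ a)}.ncard = {a | P a}.ncard := by
    intro P
    have : {a | P a} = σ '' {a | P (σ a)} := by
      ext x
      simp [Equiv.image_eq_preimage_symm]
    rw [this, Set.ncard_image_of_injective _ σ.injective]
  simp only [PathLearning.relabel]
  rw [key fun a => G.Adj a (σ v), key fun a => G.Adj (σ v) a]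
  exact h (σ v)

lemma HasHeight.relabel {G : Digraph V} {h : ℕ} (hh : HasHeight G h) (σ : Equiv.Perm V) :
    HasHeight (relabel G σ) h := by
  have : {k : ℕ | ∃ (a b : V) (p : List V), IsPath (PathLearning.relabel G σ) a b p ∧
      p.length = k + 1} = {k : ℕ | ∃ (a b : V) (p : List V), IsPath G a b p ∧
      p.length = k + 1} := by
    ext k
    constructor
    · rintro ⟨a, b, p, hp, hl⟩
      exact ⟨σ a, σ b, p.map σ, (isPath_relabel σ).1 hp, by simpa using hl⟩
    · rintro ⟨a, b, p, hp, hl⟩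
      exact ⟨σ.symm a, σ.symm b, p.map σ.symm, (isPath_relabel σ).2 (by simpa using hp),
        by simpa using hl⟩
  rw [HasHeight, this]
  exact hh

lemma relabel_mem_almostTrees {d h n : ℕ} {G : Digraph (Fin n)} (hG : G ∈ almostTrees d h n)
    (σ : Equiv.Perm (Fin n)) : relabel G σ ∈ almostTrees d h n :=
  ⟨hG.1.relabel σ, fun _ _ hab => hG.2.1 _ _ hab.of_relabel, hG.2.2.1.relabel σ,
    hG.2.2.2.relabel σ⟩

end Relabel

/-! ### Counting the members of the class -/

section Counting

variable {V : Type u}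

lemma pathQuery_iff_reflTransGen {G : Digraph V} {a b : V} :
    PathQuery G a b ↔ Relation.ReflTransGen G.Adj a b := by
  constructor
  · rintro ⟨p, hc, hh, hl⟩
    cases p with
    | nil => simp at hh
    | cons x p =>
      simp only [List.head?_cons, Option.some.injEq] at hh
      subst hh
      refine List.relationReflTransGen_of_exists_isChain_cons p hc ?_
      rw [List.getLast?_eq_getLast_of_ne_nil (by simp)] at hl
      simpa using hl
  · intro h
    obtain ⟨l, hc, hl⟩ := List.exists_isChain_cons_of_relationReflTransGen h
    exact ⟨a :: l, hc, rfl, by rw [List.getLast?_eq_getLast_of_ne_nil (by simp), hl]⟩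

lemma IsDAG.wellFounded [Finite V] {G : Digraph V} (h : IsDAG G) : WellFounded G.Adj := by
  have : Std.Irrefl (Relation.TransGen G.Adj) := ⟨h⟩
  have hwf := Finite.wellFounded_of_trans_of_irrefl (Relation.TransGen G.Adj)
  exact Subrelation.wf (fun hab => Relation.TransGen.single hab) hwf

lemma three_le_of_nonempty_almostTrees {d h n : ℕ} (hne : (almostTrees d h n).Nonempty) :
    3 ≤ n := by
  obtain ⟨G, ⟨_, T, s, t, ⟨⟨_, r, hr, _⟩, hT⟩, hst, hts, _⟩, _⟩ := hne
  have hrs : r ≠ s := by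
    rintro rfl
    obtain ⟨p, hp, _⟩ := hT r hr t
    exact hst ⟨p, hp⟩
  have hrt : r ≠ t := by
    rintro rfl
    obtain ⟨p, hp, _⟩ := hT r hr s
    exact hts ⟨p, hp⟩
  have hne : s ≠ t := by
    rintro rfl
    exact hst (pathQuery_iff_reflTransGen.2 Relation.ReflTransGen.refl)
  have : ({r, s, t} : Finset (Fin n)).card = 3 := Finset.card_eq_three.2 ⟨r, s, t, hrs, hrt, hne, rfl⟩
  calc 3 = ({r, s, t} : Finset (Fin n)).card := this.symm
    _ ≤ Fintype.card (Fin n) := Finset.card_le_univ _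
    _ = n := Fintype.card_fin n

/-- A graph with a unique root has at least as many relabellings as vertices. -/
lemma le_ncard_almostTrees {d h n : ℕ} (hne : (almostTrees d h n).Nonempty) :
    n ≤ (almostTrees d h n).ncard := by
  obtain ⟨G, hG⟩ := hne
  obtain ⟨r, hr, hu⟩ := hG.1.1.2
  have hinj : Function.Injective fun v => relabel G (Equiv.swap r v) := by
    intro v w hvw
    have h1 : IsRoot (relabel G (Equiv.swap r v)) v := by
      rw [isRoot_relabel, Equiv.swap_apply_right]
      exact hr
    simp only at hvw
    rw [hvw, isRoot_relabel] at h1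
    exact (Equiv.swap r w).injective ((hu _ h1).trans (Equiv.swap_apply_right r w).symm)
  calc n = (Set.range fun v => relabel G (Equiv.swap r v)).ncard := by
        rw [← Set.image_univ, Set.ncard_image_of_injective _ hinj, Set.ncard_univ]
        simp
    _ ≤ _ := Set.ncard_le_ncard
      (Set.range_subset_iff.2 fun v => relabel_mem_almostTrees hG _) (Set.toFinite _)

/-- Serves to number the out-neighbours of a vertex. The extra value in `Fin (d + 1)` leaves a
default outside `s` even when `d = 0`. -/
lemma exists_injOn_fin {α : Type*} [Finite α] {s : Set α} {d : ℕ} (hs : s.ncard ≤ d) :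
    ∃ f : α → Fin (d + 1), Set.InjOn f s := by
  classical
  have hf := s.toFinite
  let e := Finite.equivFin s
  have hcard : Nat.card s = s.ncard := rfl
  refine ⟨fun a => if ha : a ∈ s then ⟨e ⟨a, ha⟩, by have := (e ⟨a, ha⟩).2; omega⟩ else 0, ?_⟩
  intro a ha b hb hab
  simp only [ha, hb, dif_pos, Fin.mk.injEq] at hab
  have := e.injective (Fin.ext hab)
  simpa using this

/-- At most `(d + 1) ^ |V|` relabellings of a rooted DAG of maximum degree `d` coincide: such a
relabelling is determined by the positions of the vertices among the children of their parents. -/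
lemma card_relabel_fiber_le [Fintype V] [DecidableEq V] {G H : Digraph V} {d : ℕ}
    (hG : IsRootedDAG G) (hH : IsRootedDAG H) (hd : HasMaxDegree G d)
    (S : Finset (Equiv.Perm V)) (hS : ∀ σ ∈ S, relabel G σ = H) :
    S.card ≤ (d + 1) ^ Fintype.card V := by
  classical
  have hout : ∀ u : V, ∃ f : V → Fin (d + 1), Set.InjOn f {b | G.Adj u b} := fun u =>
    exists_injOn_fin ((Nat.le_add_left _ _).trans (hd u))
  choose f hf using hout
  obtain ⟨r, hr, hu⟩ := hG.2
  have hpar : ∀ v, ∃ u, ¬ IsRoot H v → H.Adj u v := by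
    intro v
    by_cases h : IsRoot H v
    · exact ⟨v, fun h' => absurd h h'⟩
    · simp only [IsRoot, not_forall, not_not] at h
      exact ⟨h.choose, fun _ => h.choose_spec⟩
  choose par hpar using hpar
  -- Induct along `H`: roots must go to `r`, and once the image of `par v` is known, the label
  -- singles out the image of `v` among its children.
  have hinj : Set.InjOn (fun (σ : Equiv.Perm V) v => f (σ (par v)) (σ v)) S := by
    intro σ hσ τ hτ heq
    have hσ' := hS σ hσ
    have hτ' := hS τ hτ
    ext v
    induction v using hH.1.wellFounded.induction with
    | _ v ih =>
      by_cases hv : IsRoot H v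
      · rw [hu (σ v) ((isRoot_relabel σ).1 (hσ' ▸ hv)),
          hu (τ v) ((isRoot_relabel τ).1 (hτ' ▸ hv))]
      · have hadj := hpar v hv
        have h1 : G.Adj (σ (par v)) (σ v) := by
          rw [← hσ'] at hadj
          exact hadj
        have h2 : G.Adj (τ (par v)) (τ v) := by
          rw [← hτ'] at hadj
          exact hadj
        have h3 := congrFun heq v
        have h4 := ih _ hadj
        simp only at h3
        rw [h4] at h1 h3
        exact hf _ h1 h2 h3
  calc S.card ≤ (Finset.univ : Finset (V → Fin (d + 1))).card :=
        Finset.card_le_card_of_injOn _ (fun _ _ => by simp) hinj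
    _ = _ := by simp

lemma factorial_le_ncard_almostTrees_mul {d h n : ℕ} (hne : (almostTrees d h n).Nonempty) :
    n.factorial ≤ (almostTrees d h n).ncard * (d + 1) ^ n := by
  classical
  obtain ⟨G, hG⟩ := hne
  let I : Finset (Digraph (Fin n)) := Finset.univ.image (relabel G)
  have h1 : (Finset.univ : Finset (Equiv.Perm (Fin n))).card ≤ (d + 1) ^ n * I.card := by
    refine Finset.card_le_mul_card_image _ _ fun H hH => ?_
    obtain ⟨σ, _, rfl⟩ := Finset.mem_image.1 hH
    have := card_relabel_fiber_le hG.1.1 (relabel_mem_almostTrees hG σ).1.1 hG.2.2.1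
      (Finset.univ.filter fun τ => relabel G τ = relabel G σ) (by simp)
    simpa using this
  rw [Finset.card_univ, Fintype.card_perm, Fintype.card_fin] at h1
  refine h1.trans ?_
  rw [mul_comm]
  refine Nat.mul_le_mul_right _ ?_
  rw [← Set.ncard_coe_finset]
  refine Set.ncard_le_ncard ?_ (Set.toFinite _)
  intro H hH
  obtain ⟨σ, _, rfl⟩ := Finset.mem_image.1 (Finset.mem_coe.1 hH)
  exact relabel_mem_almostTrees hG σ

end Counting

/-! ### The bound of order n log n -/

/-- The information-theoretic lower bound. -/
lemma randomizedLowerBound_of_ncard {V : Type u} [Finite V] {C : Set (Digraph V)} {q : ℕ}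
    (hC : 3 * 2 ^ q ≤ C.ncard) : RandomizedLowerBound C (((q + 1 : ℕ) : ℝ) / 3) := by
  classical
  have := Fintype.ofFinite V
  have hfin := C.toFinite
  rw [Set.ncard_eq_toFinset_card C hfin] at hC
  refine randomizedLowerBound_of_card_identified hfin.toFinset ?_ (by simp) q fun A => ?_
  · rw [← Finset.card_pos]
    have := Nat.one_le_two_pow (n := q)
    omega
  · exact (Nat.mul_le_mul_left 3 (A.card_identified_le_two_pow _ q)).trans hC

/-- Take `q` to be the integer part of the binary logarithm of `|C| / 3`. The constant bound covers
small `n`, where the logarithmic estimate may be vacuous. -/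
lemma randomizedLowerBound_log_ncard {V : Type u} [Finite V] {C : Set (Digraph V)}
    (hC : 3 ≤ C.ncard) : RandomizedLowerBound C (1 / 3) ∧
      RandomizedLowerBound C (Real.log (C.ncard / 3) / 3) := by
  have hpos : C.ncard / 3 ≠ 0 := by omega
  have h := randomizedLowerBound_of_ncard (C := C) (q := Nat.log 2 (C.ncard / 3)) (by
    have := Nat.pow_log_le_self 2 hpos
    omega)
  refine ⟨h.mono ?_, h.mono ?_⟩
  · push_cast
    have : (0 : ℝ) ≤ (Nat.log 2 (C.ncard / 3) : ℝ) := by positivity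
    linarith
  · have hlt : C.ncard < 3 * 2 ^ (Nat.log 2 (C.ncard / 3) + 1) := by
      have := Nat.lt_pow_succ_log_self (b := 2) (by norm_num) (C.ncard / 3)
      omega
    have hlt' : (C.ncard : ℝ) / 3 ≤ 2 ^ (Nat.log 2 (C.ncard / 3) + 1) := by
      have : (C.ncard : ℝ) < 3 * 2 ^ (Nat.log 2 (C.ncard / 3) + 1) := by exact_mod_cast hlt
      linarith
    have hC' : (3 : ℝ) ≤ C.ncard := by exact_mod_cast hC
    have h2 := Real.log_le_log (by positivity) hlt'
    rw [Real.log_pow] at h2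
    have h3 : Real.log 2 ≤ 1 := by linarith [Real.log_two_lt_d9]
    have h4 : (0 : ℝ) ≤ ((Nat.log 2 (C.ncard / 3) + 1 : ℕ) : ℝ) := by positivity
    nlinarith

/-- One term of the exponential series gives `n ^ n / n! ≤ exp n`, which costs one `n`; the other `2
n` absorbs `log 3`. -/
lemma mul_log_le_log_ncard {d h n : ℕ} (hne : (almostTrees d h n).Nonempty) :
    n * Real.log n - n * (3 + Real.log (d + 1)) ≤ Real.log ((almostTrees d h n).ncard / 3) := by
  have hn := three_le_of_nonempty_almostTrees hne
  have hn' : (3 : ℝ) ≤ n := by exact_mod_cast hn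
  have hA : (3 : ℝ) ≤ (almostTrees d h n).ncard := by
    exact_mod_cast hn.trans (le_ncard_almostTrees hne)
  have h1 : (n.factorial : ℝ) ≤ (almostTrees d h n).ncard * ((d : ℝ) + 1) ^ n := by
    exact_mod_cast factorial_le_ncard_almostTrees_mul hne
  have h2 := Real.log_le_log (by positivity) h1
  rw [Real.log_mul (by positivity) (by positivity), Real.log_pow] at h2
  have h3 := Real.pow_div_factorial_le_exp (n : ℝ) (by positivity) n
  have h4 := Real.log_le_log (by positivity) h3
  rw [Real.log_exp, Real.log_div (by positivity) (by positivity), Real.log_pow] at h4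
  rw [Real.log_div (by positivity) (by norm_num)]
  have h5 : Real.log 3 ≤ 3 - 1 := Real.log_le_sub_one_of_pos (by norm_num)
  nlinarith

lemma exists_randomizedLowerBound_mul_log (d : ℕ) :
    ∃ c : ℝ, 0 < c ∧ ∀ n h : ℕ, (almostTrees d h n).Nonempty →
      RandomizedLowerBound (almostTrees d h n) (c * (n * Real.log n)) := by
  set K : ℝ := 3 + Real.log (d + 1) with hK
  have hK0 : 0 < K := by
    have : 0 ≤ Real.log ((d : ℝ) + 1) := Real.log_nonneg (by simp)
    linarith
  have hE := Real.exp_pos (2 * K)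
  -- If `log n ≥ 2 K`, the error `n K` is at most half the main term, hence 1/6. Otherwise `n log n
  -- ≤ exp (2 K) * 2 K`, and the second constant brings the bound down to 1/3.
  refine ⟨min (1 / 6) (1 / (3 * (Real.exp (2 * K) * (2 * K)))), by positivity, ?_⟩
  intro n h hne
  have hn := three_le_of_nonempty_almostTrees hne
  have hn' : (3 : ℝ) ≤ n := by exact_mod_cast hn
  have hlog : 0 < Real.log n := Real.log_pos (by linarith)
  obtain ⟨hone, hlg⟩ := randomizedLowerBound_log_ncard (hn.trans (le_ncard_almostTrees hne))
  by_cases hcase : 2 * K ≤ Real.log n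
  · refine hlg.mono ?_
    have h1 := mul_log_le_log_ncard hne
    have h2 : min (1 / 6) (1 / (3 * (Real.exp (2 * K) * (2 * K)))) * (n * Real.log n) ≤
        1 / 6 * (n * Real.log n) :=
      mul_le_mul_of_nonneg_right (min_le_left _ _) (by positivity)
    rw [← hK] at h1
    nlinarith
  · refine hone.mono ?_
    push Not at hcase
    have hnE : (n : ℝ) ≤ Real.exp (2 * K) := by
      rw [← Real.exp_log (by linarith : (0 : ℝ) < n)]
      exact Real.exp_le_exp.2 hcase.le
    calc _ ≤ 1 / (3 * (Real.exp (2 * K) * (2 * K))) * (Real.exp (2 * K) * (2 * K)) := by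
          gcongr
          exact min_le_right _ _
      _ = 1 / 3 := by field_simp

/-! ### Trees given by parents, and adding an edge between leaves -/

section Trees

variable {V : Type u}

lemma lt_of_transGen {G : Digraph V} {φ : V → ℕ} (hφ : ∀ a b, G.Adj a b → φ a < φ b) {a b : V}
    (h : Relation.TransGen G.Adj a b) : φ a < φ b := by
  induction h with
  | single h => exact hφ _ _ h
  | tail _ h ih => exact ih.trans (hφ _ _ h)

lemma le_of_reflTransGen {G : Digraph V} {φ : V → ℕ} (hφ : ∀ a b, G.Adj a b → φ a < φ b) {a b : V}
    (h : Relation.ReflTransGen G.Adj a b) : φ a ≤ φ b := by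
  rcases Relation.reflTransGen_iff_eq_or_transGen.1 h with rfl | h
  · exact le_rfl
  · exact (lt_of_transGen hφ h).le

lemma isDAG_of_potential {G : Digraph V} {φ : V → ℕ} (hφ : ∀ a b, G.Adj a b → φ a < φ b) :
    IsDAG G :=
  fun _ hv => lt_irrefl _ (lt_of_transGen hφ hv)

/-- Each edge raises `φ` by at least one. With `φ` a depth function this bounds the height. -/
lemma IsPath.length_le {G : Digraph V} {φ : V → ℕ} (hφ : ∀ a b, G.Adj a b → φ a < φ b)
    {a b : V} {p : List V} (hp : IsPath G a b p) : φ a + p.length ≤ φ b + 1 := by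
  induction p generalizing a with
  | nil => simp [IsPath] at hp
  | cons x l ih =>
    obtain ⟨hc, hh, hl⟩ := hp
    simp only [List.head?_cons, Option.some.injEq] at hh
    subst hh
    cases l with
    | nil =>
      simp only [List.getLast?_singleton, Option.some.injEq] at hl
      simp [hl]
    | cons y l =>
      rw [List.isChain_cons_cons] at hc
      have h1 := ih ⟨hc.2, rfl, by simpa using hl⟩
      have h2 := hφ _ _ hc.1
      simp only [List.length_cons] at h1 ⊢
      omega

lemma IsPath.concat {G : Digraph V} {a b c : V} {p : List V} (hp : IsPath G a b p)
    (h : G.Adj b c) : IsPath G a c (p ++ [c]) := by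
  obtain ⟨hc, hh, hl⟩ := hp
  refine ⟨List.isChain_append.2 ⟨hc, by simp, ?_⟩, ?_, by simp⟩
  · intro x hx y hy
    rw [hl] at hx
    simp only [List.head?_cons, Option.mem_def, Option.some.injEq] at hx hy
    rwa [← hx, ← hy]
  · rw [List.head?_append, hh]
    rfl

lemma IsPath.eq_singleton_or_concat {G : Digraph V} {a b : V} {p : List V} (hp : IsPath G a b p) :
    (p = [b] ∧ a = b) ∨ ∃ q c, p = q ++ [b] ∧ IsPath G a c q ∧ G.Adj c b := by
  obtain ⟨hc, hh, hl⟩ := hp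
  obtain ⟨q, rfl⟩ := List.getLast?_eq_some_iff.1 hl
  rcases List.eq_nil_or_concat' q with rfl | ⟨q, c, rfl⟩
  · left
    simpa using hh.symm
  · right
    refine ⟨_, c, rfl, ⟨(List.isChain_append.1 hc).1, ?_, by simp⟩, ?_⟩
    · rw [List.head?_append, List.head?_append] at hh
      rw [List.head?_append]
      cases q <;> simpa using hh
    · exact (List.isChain_append.1 hc).2.2 c (by simp) b (by simp)

/-- `T` is a tree rooted at `r`, given by parents along which `φ` decreases. -/
structure IsParentTree (T : Digraph V) (r : V) (φ : V → ℕ) : Prop where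
  not_adj_root : ∀ a, ¬ T.Adj a r
  exists_parent : ∀ v, v ≠ r → ∃ u, T.Adj u v
  parent_unique : ∀ u u' v, T.Adj u v → T.Adj u' v → u = u'
  lt_of_adj : ∀ a b, T.Adj a b → φ a < φ b

/-- Any path to a vertex other than `r` ends with the edge from its only parent, so uniqueness
follows by induction on `φ`. -/
lemma IsParentTree.isArborescence {T : Digraph V} {r : V} {φ : V → ℕ} (hT : IsParentTree T r φ) :
    IsArborescence T := by
  have hroot : ∀ r', IsRoot T r' → r' = r := by
    intro r' hr'
    by_contra hne
    obtain ⟨u, hu⟩ := hT.exists_parent r' hne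
    exact hr' u hu
  refine ⟨⟨isDAG_of_potential hT.lt_of_adj, r, hT.not_adj_root, hroot⟩, ?_⟩
  intro r' hr' v
  rw [hroot r' hr']
  induction hv : φ v using Nat.strong_induction_on generalizing v with
  | _ k ih =>
    subst hv
    by_cases hvr : v = r
    · subst hvr
      refine ⟨[v], ⟨by simp, rfl, rfl⟩, ?_⟩
      intro p hp
      rcases IsPath.eq_singleton_or_concat hp with h | ⟨_, c, _, _, hc⟩
      · exact h.1
      · exact absurd hc (hT.not_adj_root c)
    · obtain ⟨u, hu⟩ := hT.exists_parent v hvr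
      obtain ⟨p, hp, hun⟩ := ih (φ u) (hT.lt_of_adj _ _ hu) u rfl
      refine ⟨p ++ [v], hp.concat hu, ?_⟩
      intro p' hp'
      rcases IsPath.eq_singleton_or_concat hp' with h | ⟨q, c, rfl, hq, hc⟩
      · exact absurd h.2.symm hvr
      · obtain rfl := hT.parent_unique _ _ _ hc hu
        rw [hun q hq]

/-- The graph `T` with the additional edge from `s` to `t`. -/
def addEdge (T : Digraph V) (s t : V) : Digraph V :=
  ⟨fun a b => T.Adj a b ∨ (a = s ∧ b = t)⟩

lemma eq_of_reflTransGen_of_leaf {T : Digraph V} {s b : V} (hs : ∀ b, ¬ T.Adj s b)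
    (h : Relation.ReflTransGen T.Adj s b) : b = s := by
  rcases Relation.ReflTransGen.cases_head h with h | ⟨c, hc, _⟩
  · exact h.symm
  · exact absurd hc (hs c)

/-- Adding an edge between two leaves `s` and `t` changes reachability only from `s` to `t`,
provided that all other ancestors of `s` are ancestors of `t`. -/
lemma pathQuery_addEdge {T : Digraph V} {s t : V} (hst : s ≠ t) (ht : ∀ b, ¬ T.Adj t b)
    (hs : ∀ u, T.Adj u s → Relation.ReflTransGen T.Adj u t) {a b : V} :
    PathQuery (addEdge T s t) a b ↔ Relation.ReflTransGen T.Adj a b ∨ (a, b) = (s, t) := by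
  rw [pathQuery_iff_reflTransGen]
  constructor
  · intro h
    induction h with
    | refl => exact Or.inl Relation.ReflTransGen.refl
    | @tail b c _ hbc ih =>
      rcases ih with hab | hab
      · rcases hbc with hbc | ⟨rfl, rfl⟩
        · exact Or.inl (hab.tail hbc)
        · rcases Relation.ReflTransGen.cases_tail hab with h | ⟨u, hau, hu⟩
          · rw [h]
            exact Or.inr rfl
          · exact Or.inl (hau.trans (hs u hu))
      · obtain ⟨rfl, rfl⟩ := Prod.mk.inj hab
        rcases hbc with hbc | ⟨h, _⟩
        · exact absurd hbc (ht _)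
        · exact absurd h.symm hst
  · rintro (h | h)
    · exact Relation.ReflTransGen.mono (fun _ _ h => Or.inl h) _ _ h
    · obtain ⟨rfl, rfl⟩ := Prod.mk.inj h
      exact Relation.ReflTransGen.single (Or.inr ⟨rfl, rfl⟩)

section AddEdge

variable {T : Digraph V} {r s t : V} {φ : V → ℕ}

/-- Comparing `s` with the parent of `t`, rather than with `t`, is more than acyclicity needs; the
stronger form also rules out transitive edges. -/
lemma IsParentTree.lt_of_adj_addEdge (hT : IsParentTree T r φ) (htr : t ≠ r)
    (hst : ∀ p, T.Adj p t → φ s < φ p) (a b : V) (hab : (addEdge T s t).Adj a b) : φ a < φ b := by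
  rcases hab with hab | ⟨rfl, rfl⟩
  · exact hT.lt_of_adj _ _ hab
  · obtain ⟨p, hp⟩ := hT.exists_parent _ htr
    exact (hst p hp).trans (hT.lt_of_adj _ _ hp)

lemma IsParentTree.isAlmostTree_addEdge (hT : IsParentTree T r φ) (htr : t ≠ r)
    (hs : ∀ b, ¬ T.Adj s b) (ht : ∀ b, ¬ T.Adj t b) (hst : ∀ p, T.Adj p t → φ s < φ p) :
    IsAlmostTree (addEdge T s t) := by
  have hlt := hT.lt_of_adj_addEdge htr hst
  have hne : s ≠ t := by
    rintro rfl
    exact lt_irrefl _ (hlt s s (Or.inr ⟨rfl, rfl⟩))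
  refine ⟨⟨isDAG_of_potential hlt, r, ?_, ?_⟩, T, s, t, hT.isArborescence, ?_, ?_, fun _ _ => Iff.rfl⟩
  · rintro v (hv | ⟨_, h⟩)
    · exact hT.not_adj_root v hv
    · exact htr h.symm
  · intro r' hr'
    by_contra h
    obtain ⟨u, hu⟩ := hT.exists_parent r' h
    exact hr' u (Or.inl hu)
  · rw [pathQuery_iff_reflTransGen]
    exact fun h => hne (eq_of_reflTransGen_of_leaf hs h).symm
  · rw [pathQuery_iff_reflTransGen]
    exact fun h => hne (eq_of_reflTransGen_of_leaf ht h)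

/-- Consider the last edge of a detour. Two tree edges into one vertex share their source; a detour
from the parent of `t` through `s` would have to descend in `φ`; and the leaf `s` can only leave
along the new edge, straight to `t`. -/
lemma IsParentTree.not_isTransitiveEdge_addEdge (hT : IsParentTree T r φ) (htr : t ≠ r)
    (hs : ∀ b, ¬ T.Adj s b) (hst : ∀ p, T.Adj p t → φ s < φ p) (a b : V) :
    ¬ IsTransitiveEdge (addEdge T s t) a b := by
  have hlt := hT.lt_of_adj_addEdge htr hst
  rintro ⟨hab, p, hp, hlen⟩
  obtain ⟨y, hay, hyb⟩ : ∃ y, Relation.TransGen (addEdge T s t).Adj a y ∧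
      (addEdge T s t).Adj y b := by
    rcases hp.eq_singleton_or_concat with ⟨rfl, _⟩ | ⟨q, y, rfl, hq, hy⟩
    · simp at hlen
    · refine ⟨y, ?_, hy⟩
      rcases Relation.reflTransGen_iff_eq_or_transGen.1
        (pathQuery_iff_reflTransGen.1 ⟨q, hq⟩) with rfl | h
      · have := hq.length_le hlt
        simp only [List.length_append, List.length_singleton] at hlen
        omega
      · exact h
  have hφ := lt_of_transGen hlt hay
  rcases hab with hab | ⟨rfl, rfl⟩
  · rcases hyb with hyb | ⟨rfl, rfl⟩
    · rw [hT.parent_unique _ _ _ hab hyb] at hφ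
      exact lt_irrefl _ hφ
    · exact absurd (hst a hab) hφ.asymm
  · rcases hyb with hyb | ⟨rfl, -⟩
    · obtain ⟨c, hac, hcy⟩ := Relation.TransGen.head'_iff.1 hay
      rcases hac with hac | ⟨-, rfl⟩
      · exact hs _ hac
      · exact absurd (hT.lt_of_adj _ _ hyb) (not_lt.2 (le_of_reflTransGen hlt hcy))
    · exact lt_irrefl _ hφ

lemma ncard_le_two_of_forall {α : Type*} [Finite α] {S : Set α} {f : α → ℕ}
    (hf : Function.Injective f) {x y : ℕ} (h : ∀ a ∈ S, f a = x ∨ f a = y) : S.ncard ≤ 2 := by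
  rw [← Set.ncard_image_of_injective S hf]
  refine (Set.ncard_le_ncard (t := {x, y}) ?_ (Set.toFinite _)).trans ?_
  · rintro _ ⟨a, ha, rfl⟩
    exact h a ha
  · simpa using Set.ncard_insert_le x {y}

/-- One parent and two children already use up degree 3, but the leaves `s` and `t` have room for
the new edge. -/
lemma IsParentTree.hasMaxDegree_addEdge [Finite V] (hT : IsParentTree T r φ)
    (hst : s ≠ t) (hs : ∀ b, ¬ T.Adj s b) (ht : ∀ b, ¬ T.Adj t b)
    (hout : ∀ v, {b | T.Adj v b}.ncard ≤ 2) : HasMaxDegree (addEdge T s t) 3 := by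
  have hin : ∀ v, {a | T.Adj a v}.ncard ≤ 1 := fun v =>
    (Set.ncard_le_one (Set.toFinite _)).2 fun a ha b hb => hT.parent_unique a b v ha hb
  intro v
  by_cases hvt : v = t
  · subst hvt
    have h1 : {b | (addEdge T s v).Adj v b} = ∅ := by
      ext b
      simp [addEdge, ht, hst.symm]
    have h2 : {a | (addEdge T s v).Adj a v} = insert s {a | T.Adj a v} := by
      ext a
      simp [addEdge, or_comm]
    rw [h1, h2, Set.ncard_empty]
    have := Set.ncard_insert_le s {a | T.Adj a v}
    have := hin v
    omega
  · have h2 : {a | (addEdge T s t).Adj a v} = {a | T.Adj a v} := by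
      ext a
      simp [addEdge, hvt]
    rw [h2]
    have h3 := hin v
    by_cases hvs : v = s
    · subst hvs
      have h1 : {b | (addEdge T v t).Adj v b} = {t} := by
        ext b
        simp [addEdge, hs]
      rw [h1, Set.ncard_singleton]
      omega
    · have h1 : {b | (addEdge T s t).Adj v b} = {b | T.Adj v b} := by
        ext b
        simp [addEdge, hvs]
      rw [h1]
      have := hout v
      omega

end AddEdge

end Trees

/-! ### The hard family: brooms with one added edge -/

section Broom

/-- Parents in the tree that consists of a spine `0, …, h`, leaves `h + 1 + i` hanging from the
spine vertices `i < k`, and a binary heap `h + k + 1, h + k + 2, …` hanging from `k`. -/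
def broomParent (h k v : ℕ) : ℕ :=
  if v ≤ h then v - 1 else if v ≤ h + k + 1 then v - (h + 1) else h + k + (v - (h + k)) / 2

/-- Depths in that tree. -/
def broomDepth (h k v : ℕ) : ℕ :=
  if v ≤ h then v else if v ≤ h + k then v - h else k + 1 + Nat.log 2 (v - (h + k))

/-- The tree with parents `broomParent h k`, on `n` vertices. -/
def broom (h k n : ℕ) : Digraph (Fin n) :=
  ⟨fun a b => (b : ℕ) ≠ 0 ∧ (a : ℕ) = broomParent h k b⟩

lemma broomParent_lt {h k v : ℕ} (hv : v ≠ 0) : broomParent h k v < v := by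
  unfold broomParent
  split_ifs <;> omega

lemma broomDepth_parent_lt {h k v : ℕ} (hk : k < h) (hv : v ≠ 0) :
    broomDepth h k (broomParent h k v) < broomDepth h k v := by
  by_cases h1 : v ≤ h
  · have : broomParent h k v = v - 1 := if_pos h1
    rw [this, broomDepth, broomDepth, if_pos h1, if_pos (by omega)]
    omega
  -- The heap root `h + k + 1` falls under the pendant formula, with parent `k`. Below it, heap
  -- indices `v - (h + k)` are halved and the logarithm drops by one.
  · by_cases h2 : v ≤ h + k + 1
    · have : broomParent h k v = v - (h + 1) := by rw [broomParent, if_neg h1, if_pos h2]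
      rw [this, broomDepth, broomDepth, if_neg h1, if_pos (by omega)]
      split_ifs <;> omega
    · have : broomParent h k v = h + k + (v - (h + k)) / 2 := by
        rw [broomParent, if_neg h1, if_neg h2]
      rw [this, broomDepth, broomDepth, if_neg h1, if_neg (by omega), if_neg (by omega),
        if_neg (by omega), Nat.add_sub_cancel_left, Nat.log_div_base]
      have : 0 < Nat.log 2 (v - (h + k)) := Nat.log_pos (by norm_num) (by omega)
      omega

lemma broom_isParentTree {h k n : ℕ} (hk : k < h) (hn : 0 < n) :
    IsParentTree (broom h k n) ⟨0, hn⟩ fun v => broomDepth h k v where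
  not_adj_root a ha := ha.1 rfl
  exists_parent v hv := by
    have hv' : (v : ℕ) ≠ 0 := fun h0 => hv (Fin.ext h0)
    exact ⟨⟨broomParent h k v, (broomParent_lt hv').trans v.2⟩, hv', rfl⟩
  parent_unique u u' v hu hu' := Fin.ext (hu.2.trans hu'.2.symm)
  lt_of_adj a b hab := by
    simp only [hab.2]
    exact broomDepth_parent_lt hk hab.1

lemma broom_ncard_children_le {h k n : ℕ} (hk : k < h) (v : Fin n) :
    {b | (broom h k n).Adj v b}.ncard ≤ 2 := by
  by_cases hv : (v : ℕ) ≤ h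
  · refine ncard_le_two_of_forall Fin.val_injective (x := v + 1) (y := v + (h + 1)) ?_
    rintro b ⟨hb0, hb⟩
    unfold broomParent at hb
    split_ifs at hb <;> omega
  -- Heap index `x = v - (h + k)` has children of indices `2 x` and `2 x + 1`, namely the vertices
  -- `v + x` and `v + x + 1`.
  · refine ncard_le_two_of_forall Fin.val_injective (x := v + (v - (h + k)))
      (y := v + (v - (h + k)) + 1) ?_
    rintro b ⟨hb0, hb⟩
    unfold broomParent at hb
    split_ifs at hb <;> omega

lemma broom_pendant_isLeaf {h k n i : ℕ} (hk : k < h) (hi : i < k) {s : Fin n}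
    (hs : (s : ℕ) = h + 1 + i) (b : Fin n) : ¬ (broom h k n).Adj s b := by
  rintro ⟨hb0, hb⟩
  unfold broomParent at hb
  split_ifs at hb <;> omega

/-- Heap indices run from 1 to `m`, so the children `2 j` and `2 j + 1` do not exist. -/
lemma broom_heap_isLeaf {h k m j n : ℕ} (hk : k < h) (hn : n = h + 1 + k + m) (hj : m < 2 * j)
    {t : Fin n} (ht : (t : ℕ) = h + k + j) (b : Fin n) : ¬ (broom h k n).Adj t b := by
  rintro ⟨hb0, hb⟩
  have := b.2
  unfold broomParent at hb
  split_ifs at hb <;> omega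

lemma broom_reaches_spine {h k n i v : ℕ} (hv : v ≤ h) (hi : i ≤ v) (hvn : v < n) :
    Relation.ReflTransGen (broom h k n).Adj ⟨i, hi.trans_lt hvn⟩ ⟨v, hvn⟩ := by
  induction v, hi using Nat.le_induction with
  | base => exact Relation.ReflTransGen.refl
  | succ v hi ih =>
    refine (ih (by omega) (by omega)).tail ⟨by simp, ?_⟩
    simp [broomParent, hv]

lemma broom_reaches_heap {h k n v : ℕ} (hv : h + k < v) (hvn : v < n) :
    Relation.ReflTransGen (broom h k n).Adj ⟨k, by omega⟩ ⟨v, hvn⟩ := by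
  induction v using Nat.strong_induction_on with
  | _ v ih =>
    by_cases hv1 : v = h + k + 1
    · refine Relation.ReflTransGen.single ⟨by simp; omega, ?_⟩
      simp only [broomParent]
      split_ifs <;> omega
    · have hp : broomParent h k v = h + k + (v - (h + k)) / 2 := by
        rw [broomParent, if_neg (by omega), if_neg (by omega)]
      refine (ih (h + k + (v - (h + k)) / 2) (by omega) (by omega) (by omega)).tail
        ⟨by simp; omega, hp.symm⟩

lemma broom_exists_isPath_spine {h k n v : ℕ} (hv : v ≤ h) (hvn : v < n) {G : Digraph (Fin n)}
    (hG : ∀ a b, (broom h k n).Adj a b → G.Adj a b) :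
    ∃ p : List (Fin n), IsPath G ⟨0, by omega⟩ ⟨v, hvn⟩ p ∧ p.length = v + 1 := by
  induction v with
  | zero => exact ⟨[⟨0, hvn⟩], ⟨by simp, rfl, rfl⟩, rfl⟩
  | succ v ih =>
    obtain ⟨p, hp, hl⟩ := ih (by omega) (by omega)
    refine ⟨p ++ [⟨v + 1, hvn⟩], hp.concat (hG _ _ ⟨by simp, ?_⟩), by simp [hl]⟩
    simp [broomParent, hv]

lemma broomDepth_le {h k m n : ℕ} (hk : k < h) (hn : n = h + 1 + k + m)
    (hm : k + 1 + Nat.log 2 m ≤ h) {v : ℕ} (hv : v < n) : broomDepth h k v ≤ h := by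
  unfold broomDepth
  split_ifs
  · assumption
  · omega
  · have := Nat.log_mono_right (b := 2) (show v - (h + k) ≤ m by omega)
    omega

lemma broom_addEdge_mem_almostTrees {d h k m n i j : ℕ} (hd : 3 ≤ d) (hk : k < h)
    (hn : n = h + 1 + k + m) (hm : k + 1 + Nat.log 2 m ≤ h) (hi : i < k) (hj2 : 2 ≤ j)
    (hj : m < 2 * j) {s t : Fin n} (hs : (s : ℕ) = h + 1 + i)
    (ht : (t : ℕ) = h + k + j) : addEdge (broom h k n) s t ∈ almostTrees d h n := by
  have hT := broom_isParentTree (n := n) hk (by omega)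
  have hs' := broom_pendant_isLeaf (n := n) hk hi hs
  have ht' := broom_heap_isLeaf hk hn hj ht
  have htr : t ≠ ⟨0, by omega⟩ := by
    intro h0
    have := congrArg Fin.val h0
    simp only at this
    omega
  have hne : s ≠ t := by
    rintro rfl
    omega
  -- The pendant has depth `i + 1 ≤ k`. Since `j ≥ 2`, the parent of `t` lies in the heap, at depth
  -- at least `k + 1`.
  have hst : ∀ p, (broom h k n).Adj p t → broomDepth h k s < broomDepth h k p := by
    rintro p ⟨_, hp⟩
    rw [hp, ht, hs]
    have hpar : broomParent h k (h + k + j) = h + k + j / 2 := by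
      rw [broomParent, if_neg (by omega), if_neg (by omega), Nat.add_sub_cancel_left]
    rw [hpar, broomDepth, broomDepth, if_neg (by omega), if_pos (by omega), if_neg (by omega),
      if_neg (by omega)]
    omega
  have hlt := hT.lt_of_adj_addEdge htr hst
  refine ⟨hT.isAlmostTree_addEdge htr hs' ht' hst, hT.not_isTransitiveEdge_addEdge htr hs' hst,
    fun v => (hT.hasMaxDegree_addEdge hne hs' ht' (broom_ncard_children_le hk) v).trans hd, ?_, ?_⟩
  · obtain ⟨p, hp, hl⟩ := broom_exists_isPath_spine (k := k) (n := n) (v := h) le_rfl (by omega)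
      (G := addEdge (broom h k n) s t) (fun _ _ hab => Or.inl hab)
    exact ⟨_, _, p, hp, hl⟩
  · rintro l ⟨a, b, p, hp, hl⟩
    have h1 := hp.length_le hlt
    have h2 := broomDepth_le hk hn hm b.2
    omega

/-- In the family of all graphs that add to the tree an edge from a leaf hanging from the spine
to a leaf of the heap, every query excludes at most one graph. -/
lemma randomizedLowerBound_broom {d h k m n q : ℕ} (hd : 3 ≤ d) (hk : k < h)
    (hn : n = h + 1 + k + m) (hm : k + 1 + Nat.log 2 m ≤ h) (hm2 : 2 ≤ m)
    (hq : 3 * (q + 1) ≤ k * (m - m / 2)) :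
    RandomizedLowerBound (almostTrees d h n) (((q + 1 : ℕ) : ℝ) / 3) := by
  classical
  let X : Finset (Fin k × Fin (m - m / 2)) := Finset.univ
  let s : Fin k → Fin n := fun i => ⟨h + 1 + i, by omega⟩
  -- The heap leaves are exactly the indices from `m / 2 + 1` to `m`.
  let t : Fin (m - m / 2) → Fin n := fun j => ⟨h + k + (m / 2 + 1 + j), by omega⟩
  let g : Fin k × Fin (m - m / 2) → Digraph (Fin n) := fun x => addEdge (broom h k n) (s x.1) (t x.2)
  have hmem : ∀ x, g x ∈ almostTrees d h n := fun x =>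
    broom_addEdge_mem_almostTrees hd hk hn hm x.1.2 (by omega) (by omega) rfl rfl
  have hs : ∀ i b, ¬ (broom h k n).Adj (s i) b := fun i => broom_pendant_isLeaf hk i.2 rfl
  have ht : ∀ j b, ¬ (broom h k n).Adj (t j) b := fun j =>
    broom_heap_isLeaf hk hn (j := m / 2 + 1 + j) (by omega) rfl
  have hne : ∀ i j, s i ≠ t j := by
    intro i j hij
    have := congrArg Fin.val hij
    simp only [s, t] at this
    omega
  have hpath : ∀ x a b, PathQuery (g x) a b ↔
      Relation.ReflTransGen (broom h k n).Adj a b ∨ (a, b) = (s x.1, t x.2) := by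
    intro x a b
    refine pathQuery_addEdge (hne _ _) (ht _) ?_
    -- The parent of a pendant is a spine vertex before `k`; it reaches `k` and hence the whole
    -- heap.
    rintro u ⟨_, hu⟩
    have hu' : (u : ℕ) = x.1 := by
      rw [hu]
      simp only [s, broomParent]
      split_ifs <;> omega
    have hu'' : u = ⟨x.1, by omega⟩ := Fin.ext hu'
    rw [hu'']
    exact (broom_reaches_spine (by omega) x.1.2.le (by omega)).trans
      (broom_reaches_heap (by omega) _)
  have hst_inj : ∀ x y : Fin k × Fin (m - m / 2), (s x.1, t x.2) = (s y.1, t y.2) → x = y := by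
    intro x y hxy
    obtain ⟨h1, h2⟩ := Prod.mk.inj hxy
    have h1' := congrArg Fin.val h1
    have h2' := congrArg Fin.val h2
    simp only [s, t] at h1' h2'
    exact Prod.ext (Fin.ext (by omega)) (Fin.ext (by omega))
  have hg : Function.Injective g := by
    intro x y hxy
    have h1 := (hpath x (s x.1) (t x.2)).2 (Or.inr rfl)
    rw [hxy, hpath y] at h1
    rcases h1 with h1 | h1
    · exact absurd (eq_of_reflTransGen_of_leaf (hs _) h1).symm (hne _ _)
    · exact hst_inj _ _ h1
  have hk0 : 0 < k := Nat.pos_of_ne_zero (by rintro rfl; omega)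
  let x₀ : Fin k × Fin (m - m / 2) := (⟨0, hk0⟩, ⟨0, by omega⟩)
  -- The value outside the family is arbitrary and plays no role.
  let pos : Digraph (Fin n) → Fin n × Fin n := fun G =>
    if hG : ∃ x, g x = G then (s hG.choose.1, t hG.choose.2) else (s x₀.1, t x₀.2)
  have hpos : ∀ x, pos (g x) = (s x.1, t x.2) := by
    intro x
    have hx : ∃ y, g y = g x := ⟨x, rfl⟩
    simp only [pos, dif_pos hx]
    rw [hg hx.choose_spec]
  refine randomizedLowerBound_of_card_identified (X.image g) ⟨g x₀, by simp [X]⟩ ?_ q ?_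
  · intro G hG
    obtain ⟨x, _, rfl⟩ := Finset.mem_image.1 hG
    exact hmem x
  · intro A
    have hcard : (X.image g).card = k * (m - m / 2) := by
      rw [Finset.card_image_of_injective _ hg]
      simp [X]
    have := A.card_identified_le_of_search (Relation.ReflTransGen (broom h k n).Adj) pos
      (X.image g) ?_ ?_ q
    · rw [hcard]
      exact (Nat.mul_le_mul_left 3 this).trans hq
    · intro G hG G' hG' hGG'
      obtain ⟨x, _, rfl⟩ := Finset.mem_image.1 (Finset.mem_coe.1 hG)
      obtain ⟨y, _, rfl⟩ := Finset.mem_image.1 (Finset.mem_coe.1 hG')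
      rw [hpos, hpos] at hGG'
      rw [hst_inj _ _ hGG']
    · intro G hG a b
      obtain ⟨x, _, rfl⟩ := Finset.mem_image.1 hG
      rw [hpos, hpath]

end Broom

/-! ### Choice of parameters and the bound of order n log n + n h -/

lemma randomizedLowerBound_mul_height {d h n : ℕ} {ε : ℝ} (hd : 3 ≤ d) (hε : 0 < ε)
    (hε2 : ε ≤ 1 / 2) (hn : 3 ≤ n) (hh : (h : ℝ) ≤ (1 - ε) * n)
    (hlog : 100 / ε * (Real.log n + 1) ≤ h) :
    RandomizedLowerBound (almostTrees d h n) (ε ^ 2 / 1000 * (n * h)) := by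
  have hn' : (3 : ℝ) ≤ n := by exact_mod_cast hn
  have hlog0 : 0 < Real.log n := Real.log_pos (by linarith)
  have hεh : 100 * (Real.log n + 1) ≤ ε * h := by
    calc _ = ε * (100 / ε * (Real.log n + 1)) := by field_simp
      _ ≤ _ := by gcongr
  have hhn : (h : ℝ) ≤ n := by nlinarith
  have hεn : ε * h ≤ ε * n := by gcongr
  have hεh2 : ε * h ≤ 1 / 2 * h := by gcongr
  -- Since `n - h ≥ ε n`, this `k` leaves a heap of at least `ε n / 2` vertices, and `hlog` makes
  -- its depth fit below `h`. The number of candidates is then at least `ε ^ 2 n h / 32`.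
  set k := ⌊ε * h / 4⌋₊ with hk
  have hk1 : (k : ℝ) ≤ ε * h / 4 := Nat.floor_le (by positivity)
  have hk2 : ε * h / 4 < k + 1 := Nat.lt_floor_add_one _
  have hkh : k < h := by
    have : (k : ℝ) < h := by linarith
    exact_mod_cast this
  obtain ⟨m, hm⟩ : ∃ m, n = h + 1 + k + m := by
    refine Nat.exists_eq_add_of_le ?_
    have : (h : ℝ) + 1 + k ≤ n := by nlinarith
    exact_mod_cast this
  have hm' : (n : ℝ) = h + 1 + k + m := by exact_mod_cast hm
  have hm1 : ε * n / 2 ≤ m := by nlinarith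
  have hm2 : 2 ≤ m := by
    have : (2 : ℝ) ≤ m := by linarith
    exact_mod_cast this
  have hlogm : (Nat.log 2 m : ℝ) ≤ 2 * Real.log n := by
    have h1 : ((2 ^ Nat.log 2 m : ℕ) : ℝ) ≤ n := by
      exact_mod_cast (Nat.pow_log_le_self 2 (by omega)).trans (show m ≤ n by omega)
    have h2 := Real.log_le_log (by positivity) h1
    rw [Nat.cast_pow, Real.log_pow] at h2
    have h3 : (1 : ℝ) / 2 ≤ Real.log 2 := by linarith [Real.log_two_gt_d9]
    have h4 : (Nat.log 2 m : ℝ) * (1 / 2) ≤ Nat.log 2 m * Real.log 2 := by gcongr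
    push_cast at h2
    linarith
  have hdepth : k + 1 + Nat.log 2 m ≤ h := by
    have : (k : ℝ) + 1 + Nat.log 2 m ≤ h := by linarith
    exact_mod_cast this
  have hl1 : (m : ℝ) / 2 ≤ ((m - m / 2 : ℕ) : ℝ) := by
    have : m ≤ 2 * (m - m / 2) := by omega
    have : (m : ℝ) ≤ 2 * ((m - m / 2 : ℕ) : ℝ) := by exact_mod_cast this
    linarith
  set M := k * (m - m / 2) with hM
  have hM1 : ε * h / 8 * (ε * n / 4) ≤ M := by
    rw [hM, Nat.cast_mul]
    exact mul_le_mul (by linarith) (by linarith) (by positivity) (by positivity)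
  have hM3 : 3 ≤ M := by
    have h1 : (12 : ℝ) * 25 ≤ ε * h / 8 * (ε * n / 4) :=
      mul_le_mul (by linarith) (by linarith) (by norm_num) (by positivity)
    have : (3 : ℝ) ≤ M := by linarith
    exact_mod_cast this
  -- Here `q + 1` is `M / 3` rounded down, at least `M / 6` because `M ≥ 3`. The bound is thus at
  -- least `M / 18`, and `18 * 32 < 1000`.
  refine (randomizedLowerBound_broom (q := M / 3 - 1) hd hkh hm hdepth hm2 (by omega)).mono ?_
  have h6 : (M : ℝ) ≤ 6 * ((M / 3 - 1 + 1 : ℕ) : ℝ) := by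
    have : M ≤ 6 * (M / 3 - 1 + 1) := by omega
    exact_mod_cast this
  have h7 : 0 ≤ ε ^ 2 * (n * h) := by positivity
  nlinarith

lemma exists_randomizedLowerBound_mul_log_add_mul_height {d : ℕ} {ε : ℝ} (hd : 3 ≤ d)
    (hε : 0 < ε) :
    ∃ c : ℝ, 0 < c ∧ ∀ n h : ℕ, (almostTrees d h n).Nonempty → (h : ℝ) ≤ (1 - ε) * n →
      RandomizedLowerBound (almostTrees d h n) (c * (n * Real.log n + n * h)) := by
  obtain ⟨c₁, hc₁, hbound⟩ := exists_randomizedLowerBound_mul_log d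
  set δ := min ε (1 / 2) with hδ
  have hδ0 : 0 < δ := lt_min hε (by norm_num)
  have hδ2 : δ ≤ 1 / 2 := min_le_right _ _
  -- For large `h`, `log n ≤ h` lets `n h` dominate at the cost of a factor 2. For small `h`, `log n
  -- ≥ 1` gives `h ≤ (200 / δ) log n`, and the first constant absorbs `n h`.
  refine ⟨min (c₁ / (1 + 200 / δ)) (δ ^ 2 / 2000), by positivity, fun n h hne hh => ?_⟩
  have hn := three_le_of_nonempty_almostTrees hne
  have hn' : (3 : ℝ) ≤ n := by exact_mod_cast hn
  have hlog1 : 1 ≤ Real.log n := by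
    rw [Real.le_log_iff_exp_le (by linarith)]
    linarith [Real.exp_one_lt_d9]
  have hh' : (h : ℝ) ≤ (1 - δ) * n :=
    hh.trans (mul_le_mul_of_nonneg_right (by linarith [min_le_left ε (1 / 2)]) (by linarith))
  have hcard : (0 : ℝ) ≤ n * Real.log n + n * h := by positivity
  by_cases hcase : 100 / δ * (Real.log n + 1) ≤ h
  · refine (randomizedLowerBound_mul_height hd hδ0 hδ2 hn hh' hcase).mono ?_
    have hδ1 : 1 ≤ 100 / δ := by
      rw [le_div_iff₀ hδ0]
      linarith
    have hlogh : Real.log n ≤ h := by nlinarith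
    calc _ ≤ δ ^ 2 / 2000 * (n * Real.log n + n * h) :=
          mul_le_mul_of_nonneg_right (min_le_right _ _) hcard
      _ ≤ δ ^ 2 / 2000 * (n * h + n * h) := by gcongr
      _ = _ := by ring
  · refine (hbound n h hne).mono ?_
    push Not at hcase
    have h1 : (h : ℝ) ≤ 200 / δ * Real.log n := by
      calc (h : ℝ) ≤ 100 / δ * (Real.log n + 1) := hcase.le
        _ ≤ 100 / δ * (Real.log n + Real.log n) := by gcongr
        _ = _ := by ring
    calc _ ≤ c₁ / (1 + 200 / δ) * (n * Real.log n + n * h) :=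
          mul_le_mul_of_nonneg_right (min_le_left _ _) hcard
      _ ≤ c₁ / (1 + 200 / δ) * (n * Real.log n + n * (200 / δ * Real.log n)) := by gcongr
      _ = c₁ * (n * Real.log n) := by field_simp

end PathLearning

theorem mainTheorem9 (d : ℕ) (ε : ℝ) (hε : 0 < ε) :
    ∃ c : ℝ, 0 < c ∧ ∀ n h : ℕ, (PathLearning.almostTrees d h n).Nonempty →
      (PathLearning.DeterministicLowerBound (PathLearning.almostTrees d h n)
          (c * (n * Real.log n)) ∧
        PathLearning.RandomizedLowerBound (PathLearning.almostTrees d h n)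
          (c * (n * Real.log n))) ∧
      (3 ≤ d → (h : ℝ) ≤ (1 - ε) * n →
        PathLearning.DeterministicLowerBound (PathLearning.almostTrees d h n)
          (c * (n * Real.log n + n * h)) ∧
        PathLearning.RandomizedLowerBound (PathLearning.almostTrees d h n)
          (c * (n * Real.log n + n * h))) := by
  obtain ⟨c₁, hc₁, h₁⟩ := PathLearning.exists_randomizedLowerBound_mul_log d
  obtain ⟨c₂, hc₂, h₂⟩ : ∃ c : ℝ, 0 < c ∧ ∀ n h : ℕ,
      (PathLearning.almostTrees d h n).Nonempty → 3 ≤ d → (h : ℝ) ≤ (1 - ε) * n →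
      PathLearning.RandomizedLowerBound (PathLearning.almostTrees d h n)
        (c * (n * Real.log n + n * h)) := by
    -- The constant must be chosen before `3 ≤ d` is assumed; when that fails, any positive one will
    -- do.
    by_cases hd : 3 ≤ d
    · obtain ⟨c, hc, h⟩ :=
        PathLearning.exists_randomizedLowerBound_mul_log_add_mul_height hd hε
      exact ⟨c, hc, fun n k hne _ hk => h n k hne hk⟩
    · exact ⟨1, one_pos, fun _ _ _ hd' => absurd hd' hd⟩
  refine ⟨min c₁ c₂, lt_min hc₁ hc₂, fun n h hne => ⟨?_, fun hd hh => ?_⟩⟩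
  · have hR := (h₁ n h hne).mono (B' := min c₁ c₂ * (n * Real.log n))
      (mul_le_mul_of_nonneg_right (min_le_left _ _)
        (mul_nonneg n.cast_nonneg (Real.log_natCast_nonneg n)))
    exact ⟨hR.deterministic, hR⟩
  · have hR := (h₂ n h hne hd hh).mono (B' := min c₁ c₂ * (n * Real.log n + n * h))
      (mul_le_mul_of_nonneg_right (min_le_right _ _)
        (add_nonneg (mul_nonneg n.cast_nonneg (Real.log_natCast_nonneg n)) (by positivity)))
    exact ⟨hR.deterministic, hR⟩
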